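/- Let $n\ge 1$ and let $\rho$ be a density matrix (positive semidefinite, trace one) on $\mathbb C^2\otimes\mathbb C^n$. For density matrices $\rho,\sigma$ let $F(\rho,\sigma)=\operatorname{Tr}\sqrt{\sqrt\sigma\,\rho\,\sqrt\sigma}$. A density matrix $\sigma$ on $\mathbb C^2\otimes\mathbb C^n$ is called partial incoherent if $\sum_{k=0}^{1}(|k\rangle\langle k|\otimes I)\,\sigma\,(|k\rangle\langle k|\otimes I)=\sigma$, where $|0\rangle,|1\rangle$ is the standard basis of $\mathbb C^2$. The fidelity partial coherence of $\rho$ is $$C_F^a(\rho)=\min\{\,1-F(\rho,\sigma)^2:\ \sigma \text{ partial incoherent}\,\}.$$ Write $\rho$ as a $2n\times 2n$ matrix $(\rho_{ij})_{i,j=1}^{2n}$ in the product basis in lexicographic order $|0\rangle|1\rangle,\dots,|0\rangle|n\rangle,|1\rangle|1\rangle,\dots,|1\rangle|n\rangle$. The state $\rho$ is called an X-state if $\rho_{ij}=0$ unless $j=i$ or $j=2n+1-i$. If $\rho$ is an invertible X-state, then the minimum is attained and $$C_F^a(\rho)=\frac12\Bigl(1-\sum_{i=1}^{n}\sqrt{(\rho_{ii}+\rho_{2n+1-i,\,2n+1-i})^2-4|\rho_{2n+1-i,\,i}|^2}\Bigr).$$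 In particular, for $n=2$ and a two-qubit state $$\rho=\begin{pmatrix}a&0&0&y\\0&b&x&0\\0&\overline x&c&0\\\overline y&0&0&d\end{pmatrix}\quad\text{with } bc\ne|x|^2,\ ad\ne|y|^2,$$ one has $C_F^a(\rho)=\frac12\bigl(1-\sqrt{(b+c)^2-4|x|^2}-\sqrt{(a+d)^2-4|y|^2}\bigr)$. -/

import Mathlib

open scoped MatrixOrder ComplexOrder Kronecker

noncomputable section

/-- A density matrix: positive semidefinite with unit trace. -/
def IsDensityMatrix {ι : Type*} [Fintype ι] (ρ : Matrix ι ι ℂ) : Prop :=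
  ρ.PosSemidef ∧ ρ.trace = 1

/-- The (square-root) fidelity `F(ρ, σ) = Tr √(√σ ρ √σ)`. -/
def fidelity {ι : Type*} [Fintype ι] [DecidableEq ι] (ρ σ : Matrix ι ι ℂ) : ℝ :=
  (CFC.sqrt (CFC.sqrt σ * ρ * CFC.sqrt σ)).trace.re

/-- The fidelity distance `d_F(ρ, σ) = 1 - F(ρ, σ)²`. -/
def fidelityDistance {ι : Type*} [Fintype ι] [DecidableEq ι] (ρ σ : Matrix ι ι ℂ) : ℝ :=
  1 - fidelity ρ σ ^ 2

/-- The Lüders measurement map `σ ↦ ∑ i, (|i⟩⟨i| ⊗ I) σ (|i⟩⟨i| ⊗ I)` on the system `a ⊗ b`,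
for the standard basis of `a`. -/
def luders {α β : Type*} [Fintype α] [DecidableEq α] [Fintype β] [DecidableEq β]
    (σ : Matrix (α × β) (α × β) ℂ) : Matrix (α × β) (α × β) ℂ :=
  ∑ i : α, (Matrix.single i i (1 : ℂ) ⊗ₖ (1 : Matrix β β ℂ)) * σ *
    (Matrix.single i i (1 : ℂ) ⊗ₖ (1 : Matrix β β ℂ))

/-- The partial incoherent states: the density matrices fixed by the Lüders map. -/
def partialIncoherentStates (α β : Type*) [Fintype α] [DecidableEq α] [Fintype β]
    [DecidableEq β] : Set (Matrix (α × β) (α × β) ℂ) :=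
  {σ | IsDensityMatrix σ ∧ luders σ = σ}

/-- The fidelity partial coherence: the least fidelity distance to a partial incoherent state. -/
def fidelityPartialCoherence {α β : Type*} [Fintype α] [DecidableEq α] [Fintype β]
    [DecidableEq β] (ρ : Matrix (α × β) (α × β) ℂ) : ℝ :=
  sInf (fidelityDistance ρ '' partialIncoherentStates α β)

/-- The `2n × 2n` matrix of an operator on `ℂ² ⊗ ℂⁿ` in the product basis in lexicographic order:
`|i⟩ ⊗ |j⟩` has position `n * i + j` (all counted from `0`). -/
def flatten {n : ℕ} (ρ : Matrix (Fin 2 × Fin n) (Fin 2 × Fin n) ℂ) :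
    Matrix (Fin (2 * n)) (Fin (2 * n)) ℂ :=
  Matrix.reindex finProdFinEquiv finProdFinEquiv ρ

/-- A square matrix of X shape: all entries off the diagonal and the antidiagonal vanish. -/
def IsXMatrix {N : ℕ} (M : Matrix (Fin N) (Fin N) ℂ) : Prop :=
  ∀ i j, j ≠ i → j ≠ i.rev → M i j = 0

/-- The `i`-th basis index among the first `n` of `2n`; its mirror image is `(lowIdx i).rev`. -/
def lowIdx {n : ℕ} (i : Fin n) : Fin (2 * n) :=
  Fin.castLE (Nat.le_mul_of_pos_left n Nat.zero_lt_two) i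

end

/-! Alberti's inequality gives F(ρ,σ)² ≤ Tr(ρX) Tr(σX⁻¹) for every X > 0. If X⁻¹ has identity
diagonal blocks, then Tr(σX⁻¹) = Tr σ = 1 for every partial incoherent σ, so F² ≤ Tr(ρX) uniformly
in σ. If moreover XρX is block diagonal, its normalisation is partial incoherent and attains the
bound (`isLeast_fidelityDistance_of_posDef`). After a permutation of the basis, an X-state is a
direct sum of 2 × 2 blocks, so X can be built blockwise. `exists_block_multiplier` solves a
quadratic equation for each block; the block contributes (a + d + s)/2 to Tr(ρX), where s is its
square root in the formula. Since the a + d sum to 1, Tr(ρX) = (1 + ∑ s)/2. -/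

/-! ### Alberti's bound for the fidelity -/

open Matrix in
/-- If `S` is Hermitian and `K - S X⁻¹ S` is positive semidefinite, then so is `X - S K⁻¹ S`. -/
theorem Matrix.PosDef.posSemidef_sub_mul_inv_mul {ι : Type*} [Fintype ι] [DecidableEq ι]
    {X K S : Matrix ι ι ℂ} (hX : X.PosDef) (hK : K.PosDef) (hS : S.IsHermitian)
    (h : (K - S * X⁻¹ * S).PosSemidef) : (X - S * K⁻¹ * S).PosSemidef := by
  have := hX.isUnit.invertible
  have := hK.isUnit.invertible
  -- Both conditions are Schur complements of the block matrix with rows (X, S) and (S, K).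
  have h1 := (PosDef.fromBlocks₁₁ S K hX).2 (by rwa [hS.eq])
  have h2 := (PosDef.fromBlocks₂₂ X S hK).1 h1
  rwa [hS.eq] at h2

open Matrix in
/-- The trace of a product of two positive semidefinite matrices is nonnegative. -/
theorem Matrix.PosSemidef.trace_mul_nonneg {ι : Type*} [Fintype ι] [DecidableEq ι]
    {A B : Matrix ι ι ℂ} (hA : A.PosSemidef) (hB : B.PosSemidef) : 0 ≤ (A * B).trace := by
  have hS := (CFC.sqrt_nonneg A).posSemidef
  have h := hB.mul_mul_conjTranspose_same (CFC.sqrt A)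
  rw [hS.isHermitian.eq] at h
  have h2 := h.trace_nonneg
  rwa [trace_mul_comm, ← mul_assoc, CFC.sqrt_mul_sqrt_self A hA.nonneg] at h2

open Matrix in
/-- `2 Tr G ≤ Tr (G² K⁻¹) + Tr K` for `G` Hermitian and `K` positive definite. -/
theorem Matrix.PosDef.two_mul_trace_le {ι : Type*} [Fintype ι] [DecidableEq ι]
    {G K : Matrix ι ι ℂ} (hG : G.IsHermitian) (hK : K.PosDef) :
    2 * G.trace.re ≤ (G * G * K⁻¹).trace.re + K.trace.re := by
  have hu : IsUnit K.det := (isUnit_iff_isUnit_det K).1 hK.isUnit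
  have hGK : (G - K)ᴴ = G - K := (hG.sub hK.isHermitian).eq
  -- A completed square: expand Tr (G - K) K⁻¹ (G - K) ≥ 0.
  have h := (hK.inv.posSemidef.mul_mul_conjTranspose_same (G - K)).trace_nonneg
  rw [hGK] at h
  have e : (G - K) * K⁻¹ * (G - K) = G * K⁻¹ * G - G - G + K := by
    rw [sub_mul, mul_nonsing_inv _ hu, sub_mul, one_mul, mul_sub, mul_assoc G K⁻¹ K,
      nonsing_inv_mul _ hu, mul_one]
    abel
  rw [e, trace_add, trace_sub, trace_sub, trace_mul_comm, ← mul_assoc] at h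
  have := (Complex.le_def.1 h).1
  simp only [Complex.zero_re, Complex.add_re, Complex.sub_re] at this
  linarith

open Matrix in
theorem fidelity_nonneg {ι : Type*} [Fintype ι] [DecidableEq ι] (ρ σ : Matrix ι ι ℂ) :
    0 ≤ fidelity ρ σ :=
  (Complex.le_def.1 (CFC.sqrt_nonneg (CFC.sqrt σ * ρ * CFC.sqrt σ)).posSemidef.trace_nonneg).1

open Matrix in
/-- The upper bound in Alberti's characterisation of the fidelity. -/
theorem two_mul_fidelity_le {ι : Type*} [Fintype ι] [DecidableEq ι] {ρ σ X : Matrix ι ι ℂ}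
    (hρ : ρ.PosSemidef) (hσ : σ.PosSemidef) (hX : X.PosDef) :
    2 * fidelity ρ σ ≤ (ρ * X).trace.re + (σ * X⁻¹).trace.re := by
  set S := CFC.sqrt σ with hSdef
  have hS : S.PosSemidef := (CFC.sqrt_nonneg σ).posSemidef
  have hSS : S * S = σ := CFC.sqrt_mul_sqrt_self σ hσ.nonneg
  have hM : (S * ρ * S).PosSemidef := by
    simpa only [hS.isHermitian.eq] using hρ.mul_mul_conjTranspose_same S
  set G := CFC.sqrt (S * ρ * S) with hGdef
  have hG : G.PosSemidef := (CFC.sqrt_nonneg _).posSemidef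
  have hGG : G * G = S * ρ * S := CFC.sqrt_mul_sqrt_self _ hM.nonneg
  have hSXS : (S * X⁻¹ * S).PosSemidef := by
    simpa only [hS.isHermitian.eq] using hX.inv.posSemidef.mul_mul_conjTranspose_same S
  -- S X⁻¹ S is singular when σ is, so ε • 1 is added to make K invertible; ε tends to 0 at the end.
  have key : ∀ ε : ℝ, 0 < ε → 2 * fidelity ρ σ ≤
      (ρ * X).trace.re + (σ * X⁻¹).trace.re + ε * Fintype.card ι := by
    intro ε hε
    have hε1 : ((ε : ℂ) • (1 : Matrix ι ι ℂ)).PosDef :=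
      PosDef.one.smul (by exact_mod_cast hε)
    have hK := PosDef.posSemidef_add hSXS hε1
    set K := S * X⁻¹ * S + (ε : ℂ) • (1 : Matrix ι ι ℂ) with hKdef
    have h1 := PosDef.two_mul_trace_le hG.isHermitian hK
    have h2 := hρ.trace_mul_nonneg (hX.posSemidef_sub_mul_inv_mul hK hS.isHermitian
      (by rw [hKdef, add_sub_cancel_left]; exact hε1.posSemidef))
    have h3 : (ρ * (S * K⁻¹ * S)).trace = (G * G * K⁻¹).trace := by
      rw [hGG, ← mul_assoc, trace_mul_comm]
      simp only [mul_assoc]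
    have h4 : K.trace = (σ * X⁻¹).trace + (ε : ℂ) * Fintype.card ι := by
      rw [hKdef, trace_add, trace_mul_comm, ← mul_assoc, hSS, trace_smul, trace_one, smul_eq_mul]
    rw [mul_sub, trace_sub, h3] at h2
    have h5 := (Complex.le_def.1 h2).1
    have h6 : ((ε : ℂ) * (Fintype.card ι : ℂ)).re = ε * Fintype.card ι := by simp
    rw [h4, Complex.add_re, h6] at h1
    rw [Complex.sub_re, Complex.zero_re] at h5
    have : fidelity ρ σ = G.trace.re := rfl
    linarith
  refine le_of_forall_pos_le_add fun δ hδ => ?_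
  have hc : (0 : ℝ) < Fintype.card ι + 1 := by positivity
  refine (key (δ / (Fintype.card ι + 1)) (by positivity)).trans ?_
  gcongr
  rw [div_mul_eq_mul_div, div_le_iff₀ hc]
  nlinarith

open Matrix in
/-- The multiplicative form of Alberti's upper bound. -/
theorem fidelity_sq_le {ι : Type*} [Fintype ι] [DecidableEq ι] {ρ σ X : Matrix ι ι ℂ}
    (hρ : ρ.PosSemidef) (hσ : σ.PosSemidef) (hX : X.PosDef) (h0 : 0 < (ρ * X).trace.re)
    (h1 : (σ * X⁻¹).trace = 1) : fidelity ρ σ ^ 2 ≤ (ρ * X).trace.re := by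
  -- Rescaling X by 1/√A balances the two terms of the additive bound: each becomes √A.
  set A := (ρ * X).trace.re with hA
  have hs : 0 < √A := Real.sqrt_pos.2 h0
  have hc : (0 : ℂ) < ((√A)⁻¹ : ℝ) := by exact_mod_cast inv_pos.2 hs
  have hinv : ((((√A)⁻¹ : ℝ) : ℂ) • X)⁻¹ = ((√A : ℝ) : ℂ) • X⁻¹ := by
    have hu : IsUnit X.det := (isUnit_iff_isUnit_det X).1 hX.isUnit
    refine inv_eq_right_inv ?_
    rw [smul_mul_smul_comm, mul_nonsing_inv _ hu, ← Complex.ofReal_mul, inv_mul_cancel₀ hs.ne',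
      Complex.ofReal_one, one_smul]
  have h := two_mul_fidelity_le hρ hσ (hX.smul hc)
  rw [hinv, mul_smul_comm, mul_smul_comm, trace_smul, trace_smul, h1, smul_eq_mul, smul_eq_mul,
    mul_one, Complex.re_ofReal_mul, Complex.ofReal_re, ← hA] at h
  have hAA : (√A)⁻¹ * A = √A := by
    nth_rewrite 2 [← Real.mul_self_sqrt h0.le]
    field_simp
  rw [hAA] at h
  calc fidelity ρ σ ^ 2 ≤ √A ^ 2 := pow_le_pow_left₀ (fidelity_nonneg ρ σ) (by linarith) 2
    _ = A := Real.sq_sqrt h0.le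

open Matrix in
/-- Equality in Alberti's bound: the fidelity of `c⁻¹ Z σ Z` and `σ`. -/
theorem fidelity_smul_mul_mul {ι : Type*} [Fintype ι] [DecidableEq ι] {ρ σ Z : Matrix ι ι ℂ}
    (hσ : σ.PosSemidef) (hZ : Z.PosSemidef) {c : ℝ} (hc : 0 ≤ c)
    (h : ρ = ((c ^ 2 : ℝ) : ℂ) • (Z * σ * Z)) : fidelity ρ σ = c * (σ * Z).trace.re := by
  have hS : (CFC.sqrt σ).PosSemidef := (CFC.sqrt_nonneg σ).posSemidef
  have hSS : CFC.sqrt σ * CFC.sqrt σ = σ := CFC.sqrt_mul_sqrt_self σ hσ.nonneg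
  set S := CFC.sqrt σ with hSdef
  have hSZS : (S * Z * S).PosSemidef := by
    simpa only [hS.isHermitian.eq] using hZ.mul_mul_conjTranspose_same S
  have hQ : ((c : ℂ) • (S * Z * S)).PosSemidef := hSZS.smul (by exact_mod_cast hc)
  -- S ρ S = c² S Z S S Z S is the square of the positive semidefinite matrix c S Z S.
  have hsqrt : CFC.sqrt (S * ρ * S) = (c : ℂ) • (S * Z * S) := by
    refine CFC.sqrt_unique ?_ hQ.nonneg
    rw [h, smul_mul_smul_comm, mul_smul_comm, smul_mul_assoc]
    congr 1
    · push_cast; ring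
    · rw [← hSS]; simp only [mul_assoc]
  rw [fidelity, ← hSdef, hsqrt, trace_smul, trace_mul_comm, ← mul_assoc, hSS, smul_eq_mul,
    Complex.re_ofReal_mul]

/-! ### Partial incoherent states and the optimality criterion -/

open Matrix in
theorem luders_apply {α β : Type*} [Fintype α] [DecidableEq α] [Fintype β] [DecidableEq β]
    (σ : Matrix (α × β) (α × β) ℂ) (p q : α × β) :
    luders σ p q = if p.1 = q.1 then σ p q else 0 := by
  have h : ∀ i : α, (single i i (1 : ℂ) ⊗ₖ (1 : Matrix β β ℂ)) =
      diagonal fun r : α × β => if r.1 = i then 1 else 0 := by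
    intro i
    ext r s
    rcases eq_or_ne r s with rfl | hrs
    · by_cases hr : r.1 = i
      · simp [kroneckerMap_apply, hr]
      · simp [kroneckerMap_apply, hr, Ne.symm hr]
    · rw [diagonal_apply_ne _ hrs, kroneckerMap_apply, single_apply, one_apply]
      by_cases h2 : r.2 = s.2
      · rw [if_neg, zero_mul]
        rintro ⟨h3, h4⟩
        exact hrs (Prod.ext (h3.symm.trans h4) h2)
      · rw [if_neg h2, mul_zero]
  simp only [luders, h, Matrix.sum_apply, diagonal_mul, mul_diagonal]
  by_cases hpq : p.1 = q.1
  · simp [hpq]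
  · rw [if_neg hpq]
    refine Finset.sum_eq_zero fun i _ => ?_
    by_cases hp : p.1 = i
    · rw [if_neg fun h : q.1 = i => hpq (hp.trans h.symm), mul_zero]
    · simp [hp]

open Matrix in
theorem luders_eq_self_iff {α β : Type*} [Fintype α] [DecidableEq α] [Fintype β] [DecidableEq β]
    {σ : Matrix (α × β) (α × β) ℂ} : luders σ = σ ↔ ∀ p q, p.1 ≠ q.1 → σ p q = 0 := by
  constructor
  · intro h p q hpq
    rw [← h, luders_apply, if_neg hpq]
  · intro h
    ext p q
    rw [luders_apply]
    split_ifs with hpq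
    · rfl
    · exact (h p q hpq).symm

open Matrix in
/-- A positive definite `X` such that `X⁻¹` has identity diagonal blocks and `X ρ X` is block
diagonal determines the least fidelity distance of `ρ` to the partial incoherent states. -/
theorem isLeast_fidelityDistance_of_posDef {α β : Type*} [Fintype α] [DecidableEq α] [Fintype β]
    [DecidableEq β] {ρ X : Matrix (α × β) (α × β) ℂ} (hρ : IsDensityMatrix ρ) (hX : X.PosDef)
    (h0 : 0 < (ρ * X).trace.re)
    (hinv : ∀ p q, p.1 = q.1 → X⁻¹ p q = (1 : Matrix (α × β) (α × β) ℂ) p q)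
    (hblock : ∀ p q, p.1 ≠ q.1 → (X * ρ * X) p q = 0) :
    IsLeast (fidelityDistance ρ '' partialIncoherentStates α β) (1 - (ρ * X).trace.re) := by
  have hu : IsUnit X.det := (isUnit_iff_isUnit_det X).1 hX.isUnit
  have htr : ∀ σ : Matrix (α × β) (α × β) ℂ, (∀ p q, p.1 ≠ q.1 → σ p q = 0) →
      (σ * X⁻¹).trace = σ.trace := by
    intro σ hσ
    conv_rhs => rw [← mul_one σ]
    simp only [trace, diag_apply, mul_apply]
    refine Finset.sum_congr rfl fun p _ => Finset.sum_congr rfl fun q _ => ?_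
    by_cases hpq : p.1 = q.1
    · rw [hinv q p hpq.symm]
    · rw [hσ p q hpq, zero_mul, zero_mul]
  set A := (ρ * X).trace.re with hA
  have hAC : (ρ * X).trace = (A : ℂ) :=
    Complex.ext rfl (Complex.le_def.1 (hρ.1.trace_mul_nonneg hX.posSemidef)).2.symm
  have hA0 : (A : ℂ) ≠ 0 := by exact_mod_cast h0.ne'
  constructor
  · set σ := ((A⁻¹ : ℝ) : ℂ) • (X * ρ * X) with hσdef
    have hσ : σ.PosSemidef := by
      refine PosSemidef.smul ?_ (by exact_mod_cast (inv_pos.2 h0).le)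
      simpa only [hX.isHermitian.eq] using hρ.1.mul_mul_conjTranspose_same X
    have hσb : ∀ p q, p.1 ≠ q.1 → σ p q = 0 := fun p q hpq => by
      rw [hσdef, Matrix.smul_apply, hblock p q hpq, smul_zero]
    have hσ1 : σ.trace = 1 := by
      rw [← htr σ hσb, hσdef, smul_mul_assoc, mul_assoc, mul_nonsing_inv _ hu, mul_one,
        trace_smul, trace_mul_comm, hAC, smul_eq_mul, Complex.ofReal_inv, inv_mul_cancel₀ hA0]
    refine ⟨σ, ⟨⟨hσ, hσ1⟩, luders_eq_self_iff.2 hσb⟩, ?_⟩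
    -- Undoing the definition of σ gives ρ = A X⁻¹ σ X⁻¹, the equality case with Z = X⁻¹ and c = √A.
    have hF : fidelity ρ σ = √A * (σ * X⁻¹).trace.re := by
      refine fidelity_smul_mul_mul hσ hX.inv.posSemidef (Real.sqrt_nonneg A) ?_
      rw [Real.sq_sqrt h0.le, hσdef, mul_smul_comm, smul_mul_assoc, smul_smul,
        Complex.ofReal_inv, mul_inv_cancel₀ hA0, one_smul]
      calc ρ = (X⁻¹ * X) * ρ * (X * X⁻¹) := by
            rw [nonsing_inv_mul _ hu, mul_nonsing_inv _ hu, one_mul, mul_one]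
        _ = _ := by simp only [mul_assoc]
    rw [fidelityDistance, hF, htr σ hσb, hσ1, Complex.one_re, mul_one, Real.sq_sqrt h0.le]
  · rintro _ ⟨σ, ⟨hσ, hl⟩, rfl⟩
    have h1 := htr σ (luders_eq_self_iff.1 hl)
    rw [hσ.2] at h1
    have := fidelity_sq_le hρ.1 hσ.1 hX h0 h1
    rw [fidelityDistance]
    linarith

/-! ### The 2 × 2 problem -/

open Matrix in
theorem Matrix.PosSemidef.blockDiagonal {o m : Type*} [Fintype o] [DecidableEq o] [Fintype m]
    [DecidableEq m] {M : o → Matrix m m ℂ} (hM : ∀ i, (M i).PosSemidef) :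
    (blockDiagonal M).PosSemidef := by
  have h : Matrix.blockDiagonal M =
      (Matrix.blockDiagonal fun i => CFC.sqrt (M i))ᴴ *
        Matrix.blockDiagonal fun i => CFC.sqrt (M i) := by
    rw [blockDiagonal_conjTranspose, ← blockDiagonal_mul]
    congr 1
    funext i
    rw [(CFC.sqrt_nonneg (M i)).posSemidef.isHermitian.eq, CFC.sqrt_mul_sqrt_self _ (hM i).nonneg]
  rw [h]
  exact posSemidef_conjTranspose_mul_self _

open Matrix in
/-- The optimal `X` for a single `2 × 2` block. -/
theorem exists_block_multiplier {a d : ℝ} {y : ℂ} (ha : 0 < a) (hd : 0 < d)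
    (hdet : ‖y‖ ^ 2 < a * d) :
    ∃ X Z : Matrix (Fin 2) (Fin 2) ℂ, X.PosSemidef ∧ X * Z = 1 ∧ (∀ i, Z i i = 1) ∧
      (∀ i j, i ≠ j → (X * !![(a : ℂ), y; star y, d] * X) i j = 0) ∧
      (!![(a : ℂ), y; star y, d] * X).trace =
        (((a + d + √((a + d) ^ 2 - 4 * ‖y‖ ^ 2)) / 2 : ℝ) : ℂ) := by
  set N := ‖y‖ ^ 2 with hN
  have hpos : 0 < (a + d) ^ 2 - 4 * N := by nlinarith [sq_nonneg (a - d)]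
  set s := √((a + d) ^ 2 - 4 * N) with hs
  have hs0 : 0 < s := Real.sqrt_pos.2 hpos
  have hss : s ^ 2 = (a + d) ^ 2 - 4 * N := Real.sq_sqrt hpos.le
  have hN4 : N = ((a + d) ^ 2 - s ^ 2) / 4 := by linarith
  have hps : 0 < a + d + s := by positivity
  -- The off-diagonal entries of XMX, for M the given block, vanish when 1 - w(a + d) + w²N = 0.
  -- This is the smaller root, for which w²N < 1, written so that N = 0 is allowed; r = 1/(1 - w²N)
  -- normalises X.
  set w := 2 / (a + d + s) with hw
  set r := (a + d + s) / (2 * s) with hr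
  have hr0 : 0 < r := by positivity
  have e1 : r * (1 - w ^ 2 * N) = 1 := by
    rw [hr, hw, hN4]; field_simp; ring
  have e2 : 1 - w * (a + d) + w ^ 2 * N = 0 := by
    rw [hw, hN4]; field_simp; ring
  have e3 : r * (a + d - 2 * w * N) = (a + d + s) / 2 := by
    rw [hr, hw, hN4]; field_simp; ring
  have hyy : y * star y = (N : ℂ) := by
    rw [Complex.star_def, Complex.mul_conj, Complex.normSq_eq_norm_sq]
  have c1 : (r : ℂ) * (1 - w ^ 2 * N) = 1 := by exact_mod_cast e1
  have c2 : 1 - (w : ℂ) * (a + d) + w ^ 2 * N = 0 := by exact_mod_cast e2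
  have c3 : (r : ℂ) * (a + d - 2 * w * N) = (((a + d + s) / 2 : ℝ) : ℂ) := by exact_mod_cast e3
  rw [← hyy, Complex.star_def] at c1 c2 c3
  refine ⟨(r : ℂ) • !![1, -(w * y); -(w * star y), 1], !![1, w * y; w * star y, 1],
    ?_, ?_, ?_, ?_, ?_⟩
  · have hdec : (!![1, -(w * y); -(w * star y), 1] : Matrix (Fin 2) (Fin 2) ℂ) =
        vecMulVec ![1, -(w * star y)] (star ![1, -(w * star y)]) +
          diagonal ![0, ((1 - w ^ 2 * N : ℝ) : ℂ)] := by
      push_cast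
      rw [← hyy]
      ext i j
      rw [Matrix.add_apply, vecMulVec_apply, diagonal_apply]
      fin_cases i <;> fin_cases j <;> simp
      ring
    have hle : 0 ≤ 1 - w ^ 2 * N := by
      by_contra h
      push Not at h
      nlinarith [mul_pos_of_neg_of_neg h (neg_neg_of_pos hr0)]
    rw [hdec]
    refine PosSemidef.smul (PosSemidef.add (posSemidef_vecMulVec_self_star _) ?_)
      (by exact_mod_cast hr0.le)
    rw [posSemidef_diagonal_iff]
    intro i
    fin_cases i
    · simp
    · simpa only [Fin.mk_one, cons_val_one, cons_val_fin_one] using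
        (by exact_mod_cast hle : (0 : ℂ) ≤ ((1 - w ^ 2 * N : ℝ) : ℂ))
  · rw [smul_mul_assoc, mul_fin_two, one_fin_two, smul_of]
    ext i j
    fin_cases i <;> fin_cases j <;> simp <;> linear_combination c1
  · intro i
    fin_cases i <;> rfl
  · have h : ∀ i j, i ≠ j → ((!![1, -(w * y); -(w * star y), 1] : Matrix (Fin 2) (Fin 2) ℂ) *
        !![(a : ℂ), y; star y, d] * !![1, -(w * y); -(w * star y), 1]) i j = 0 := by
      rw [mul_fin_two, mul_fin_two]
      intro i j hij
      fin_cases i <;> fin_cases j <;> simp at hij ⊢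
      · linear_combination y * c2
      · linear_combination starRingEnd ℂ y * c2
    intro i j hij
    rw [smul_mul_assoc, smul_mul_assoc, mul_smul_comm, Matrix.smul_apply, Matrix.smul_apply, h i j hij,
      smul_zero, smul_zero]
  · rw [mul_smul_comm, trace_smul, mul_fin_two, trace_fin_two_of, smul_eq_mul, ← c3, Complex.star_def]
    ring

/-! ### X-states as direct sums of 2 × 2 blocks -/

/-- The involution of `Fin 2 × Fin n` reversing the second factor over `1`; it carries the
antidiagonal pairing of indices to `(0, j) ↔ (1, j)`. -/
def revOnOne (n : ℕ) : Fin 2 × Fin n ≃ Fin 2 × Fin n :=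
  Function.Involutive.toPerm (fun p => (p.1, if p.1 = 0 then p.2 else p.2.rev)) fun p => by
    by_cases h : p.1 = 0 <;> ext <;> simp [h]

@[simp] theorem revOnOne_zero {n : ℕ} (j : Fin n) : revOnOne n (0, j) = (0, j) := rfl

@[simp] theorem revOnOne_one {n : ℕ} (j : Fin n) : revOnOne n (1, j) = (1, j.rev) := rfl

theorem revOnOne_revOnOne {n : ℕ} (p : Fin 2 × Fin n) : revOnOne n (revOnOne n p) = p :=
  (revOnOne n).left_inv p

theorem finProdFinEquiv_rev {n : ℕ} (p : Fin 2 × Fin n) :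
    (finProdFinEquiv p).rev = finProdFinEquiv (p.1.rev, p.2.rev) := by
  obtain ⟨i, j⟩ := p
  ext
  fin_cases i <;> simp [Fin.val_rev] <;> omega

theorem lowIdx_eq {n : ℕ} (i : Fin n) : lowIdx i = finProdFinEquiv ((0 : Fin 2), i) := by
  ext
  simp [lowIdx]

theorem lowIdx_rev {n : ℕ} (i : Fin n) : (lowIdx i).rev = finProdFinEquiv ((1 : Fin 2), i.rev) := by
  rw [lowIdx_eq, finProdFinEquiv_rev]
  rfl

theorem flatten_finProdFinEquiv {n : ℕ} (ρ : Matrix (Fin 2 × Fin n) (Fin 2 × Fin n) ℂ)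
    (p q : Fin 2 × Fin n) : flatten ρ (finProdFinEquiv p) (finProdFinEquiv q) = ρ p q := by
  simp [flatten]

/-- The `2 × 2` blocks of an X-matrix. -/
def xBlock {n : ℕ} (ρ : Matrix (Fin 2 × Fin n) (Fin 2 × Fin n) ℂ) (j : Fin n) :
    Matrix (Fin 2) (Fin 2) ℂ :=
  ρ.submatrix (fun i => revOnOne n (i, j)) fun i => revOnOne n (i, j)

open Matrix in
theorem eq_submatrix_blockDiagonal_xBlock {n : ℕ}
    {ρ : Matrix (Fin 2 × Fin n) (Fin 2 × Fin n) ℂ} (hx : IsXMatrix (flatten ρ)) :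
    ρ = (blockDiagonal (xBlock ρ)).submatrix (revOnOne n) (revOnOne n) := by
  have h : ρ.submatrix (revOnOne n) (revOnOne n) = blockDiagonal (xBlock ρ) := by
    ext ⟨i, j⟩ ⟨k, l⟩
    rw [blockDiagonal_apply]
    split_ifs with hjl
    · dsimp only at hjl
      subst hjl
      rfl
    · refine (flatten_finProdFinEquiv ρ (revOnOne n (i, j)) (revOnOne n (k, l))).symm.trans
        (hx _ _ ?_ ?_)
      · intro he
        have := (revOnOne n).injective (finProdFinEquiv.injective he)
        exact hjl (congrArg Prod.snd this).symm
      -- The mirror image of an index keeps its label j in the permuted coordinates, so the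
      -- antidiagonal also stays inside a block.
      · intro he
        rw [finProdFinEquiv_rev] at he
        have h2 : ((revOnOne n (i, j)).1.rev, (revOnOne n (i, j)).2.rev) =
            revOnOne n (i.rev, j) := by
          fin_cases i
          · rfl
          · simp
        rw [h2] at he
        have := (revOnOne n).injective (finProdFinEquiv.injective he)
        exact hjl (congrArg Prod.snd this).symm
  rw [← h]
  ext p q
  rw [submatrix_apply, submatrix_apply, revOnOne_revOnOne, revOnOne_revOnOne]

open Matrix in
theorem Matrix.PosDef.exists_xBlock_eq {n : ℕ} {ρ : Matrix (Fin 2 × Fin n) (Fin 2 × Fin n) ℂ}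
    (hρ : ρ.PosDef) (j : Fin n) : ∃ (a d : ℝ) (y : ℂ), 0 < a ∧ 0 < d ∧ ‖y‖ ^ 2 < a * d ∧
      xBlock ρ j = !![(a : ℂ), y; star y, d] := by
  have hM : (xBlock ρ j).PosDef := hρ.submatrix fun i k h =>
    congrArg Prod.fst ((revOnOne n).injective h)
  set M := xBlock ρ j
  have hreal : ∀ i, 0 < (M i i).re ∧ M i i = ((M i i).re : ℂ) := fun i => by
    have := Complex.lt_def.1 (hM.diag_pos (i := i))
    exact ⟨this.1, Complex.ext rfl this.2.symm⟩
  have hM10 : M 1 0 = star (M 0 1) := (hM.isHermitian.apply 1 0).symm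
  refine ⟨(M 0 0).re, (M 1 1).re, M 0 1, (hreal 0).1, (hreal 1).1, ?_, ?_⟩
  · have hdet := hM.det_pos
    rw [det_fin_two, hM10, Complex.star_def, Complex.mul_conj, Complex.normSq_eq_norm_sq,
      (hreal 0).2, (hreal 1).2] at hdet
    have : (0 : ℝ) < (M 0 0).re * (M 1 1).re - ‖M 0 1‖ ^ 2 := by exact_mod_cast hdet
    linarith
  · rw [← (hreal 0).2, ← (hreal 1).2, ← hM10]
    exact eta_fin_two M

open Matrix in
theorem isLeast_fidelityDistance_of_isXMatrix {n : ℕ}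
    {ρ : Matrix (Fin 2 × Fin n) (Fin 2 × Fin n) ℂ} (hρ : IsDensityMatrix ρ) (hu : IsUnit ρ)
    (hx : IsXMatrix (flatten ρ)) :
    IsLeast (fidelityDistance ρ '' partialIncoherentStates (Fin 2) (Fin n))
      (1 / 2 * (1 - ∑ i : Fin n,
          √(((flatten ρ (lowIdx i) (lowIdx i)).re
              + (flatten ρ (lowIdx i).rev (lowIdx i).rev).re) ^ 2
            - 4 * ‖flatten ρ (lowIdx i).rev (lowIdx i)‖ ^ 2))) := by
  set e := revOnOne n with he
  choose a d y ha hd hy hM using (hρ.1.posDef_iff_isUnit.2 hu).exists_xBlock_eq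
  choose X Z hX hXZ hZ hoff htrace using fun j => exists_block_multiplier (ha j) (hd j) (hy j)
  have hsum : ∑ i : Fin n,
      √(((flatten ρ (lowIdx i) (lowIdx i)).re + (flatten ρ (lowIdx i).rev (lowIdx i).rev).re) ^ 2
        - 4 * ‖flatten ρ (lowIdx i).rev (lowIdx i)‖ ^ 2) =
      ∑ j, √((a j + d j) ^ 2 - 4 * ‖y j‖ ^ 2) := by
    refine Finset.sum_congr rfl fun j _ => ?_
    have h00 : ρ (0, j) (0, j) = a j := congrFun (congrFun (hM j) 0) 0
    have h11 : ρ (1, j.rev) (1, j.rev) = d j := congrFun (congrFun (hM j) 1) 1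
    have h10 : ρ (1, j.rev) (0, j) = star (y j) := congrFun (congrFun (hM j) 1) 0
    rw [lowIdx_rev, lowIdx_eq, flatten_finProdFinEquiv, flatten_finProdFinEquiv,
      flatten_finProdFinEquiv, h00, h11, h10, norm_star, Complex.ofReal_re, Complex.ofReal_re]
  have hρe := eq_submatrix_blockDiagonal_xBlock hx
  rw [funext hM, ← he] at hρe
  have htr : ∀ B : Fin n → Matrix (Fin 2) (Fin 2) ℂ,
      ((blockDiagonal B).submatrix e e).trace = ∑ j, (B j).trace := fun B => by
    rw [← trace_blockDiagonal]
    exact e.sum_comp fun p => blockDiagonal B p p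
  have hone : ∑ j, (a j + d j) = 1 := by
    have h := hρ.2
    rw [hρe, htr] at h
    simp only [trace_fin_two_of] at h
    exact_mod_cast h
  set XX := (blockDiagonal X).submatrix e e with hXX
  set ZZ := (blockDiagonal Z).submatrix e e with hZZ
  have hXZ1 : XX * ZZ = 1 := by
    rw [hXX, hZZ, submatrix_mul_equiv, ← blockDiagonal_mul, funext hXZ]
    refine Eq.trans ?_ (submatrix_one_equiv (α := ℂ) e)
    exact congrArg (fun A => A.submatrix e e)
      (blockDiagonal_one (m := Fin 2) (o := Fin n) (α := ℂ))
  -- Semidefiniteness passes to the direct sum blockwise; the explicit inverse upgrades it to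
  -- definiteness.
  have hXpos : XX.PosDef :=
    ((PosSemidef.blockDiagonal hX).submatrix e).posDef_iff_isUnit.2 (IsUnit.of_mul_eq_one _ hXZ1)
  have hinv : XX⁻¹ = ZZ := inv_eq_right_inv hXZ1
  have htrace' : (ρ * XX).trace.re =
      (1 + ∑ j, √((a j + d j) ^ 2 - 4 * ‖y j‖ ^ 2)) / 2 := by
    rw [hρe, hXX, submatrix_mul_equiv, ← blockDiagonal_mul, htr]
    simp only [htrace]
    rw [← Complex.ofReal_sum, Complex.ofReal_re, ← Finset.sum_div, Finset.sum_add_distrib, hone]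
  have hs : 0 ≤ ∑ j, √((a j + d j) ^ 2 - 4 * ‖y j‖ ^ 2) :=
    Finset.sum_nonneg fun _ _ => Real.sqrt_nonneg _
  have key := isLeast_fidelityDistance_of_posDef hρ hXpos (by rw [htrace']; positivity) ?_ ?_
  · rw [htrace'] at key
    rw [hsum]
    convert key using 1
    ring
  · intro p q hpq
    have h : ∀ p q : Fin 2 × Fin n, p.1 = q.1 → blockDiagonal Z p q = (1 : Matrix _ _ ℂ) p q := by
      rintro ⟨i, j⟩ ⟨k, l⟩ hik
      dsimp only at hik
      subst hik
      by_cases hjl : j = l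
      · subst hjl
        rw [blockDiagonal_apply_eq, hZ, one_apply_eq]
      · rw [blockDiagonal_apply_ne _ _ _ hjl, one_apply_ne fun h => hjl (congrArg Prod.snd h)]
    rw [hinv]
    exact (h (e p) (e q) hpq).trans (congrFun (congrFun (submatrix_one_equiv (α := ℂ) e) p) q)
  · intro p q hpq
    have h : XX * ρ * XX = (blockDiagonal fun j =>
        X j * !![(a j : ℂ), y j; star (y j), d j] * X j).submatrix e e := by
      rw [hρe, hXX, submatrix_mul_equiv, submatrix_mul_equiv, ← blockDiagonal_mul,
        ← blockDiagonal_mul]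
    rw [h, submatrix_apply, blockDiagonal_apply]
    split_ifs
    · exact hoff _ _ _ hpq
    · rfl

/-! ### The two-qubit case and the main theorem -/

open Matrix in
theorem isUnit_of_det_flatten_ne_zero {n : ℕ} {ρ : Matrix (Fin 2 × Fin n) (Fin 2 × Fin n) ℂ}
    (h : (flatten ρ).det ≠ 0) : IsUnit ρ := by
  rw [flatten, det_reindex_self] at h
  exact (isUnit_iff_isUnit_det ρ).2 (isUnit_iff_ne_zero.2 h)

open Matrix in
theorem det_x_fin_four (a b c d y x x' y' : ℂ) :
    (!![a, 0, 0, y; 0, b, x, 0; 0, x', c, 0; y', 0, 0, d] : Matrix (Fin 4) (Fin 4) ℂ).det =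
      (a * d - y * y') * (b * c - x * x') := by
  simp [det_succ_row_zero, Fin.sum_univ_succ, Fin.succAbove]
  ring

theorem mainTheorem11 :
    (∀ (a b c d : ℝ) (x y : ℂ) (ρ : Matrix (Fin 2 × Fin 2) (Fin 2 × Fin 2) ℂ),
      IsDensityMatrix ρ →
      flatten ρ = !![(a : ℂ), 0, 0, y;
                     0, (b : ℂ), x, 0;
                     0, star x, (c : ℂ), 0;
                     star y, 0, 0, (d : ℂ)] →
      b * c ≠ ‖x‖ ^ 2 → a * d ≠ ‖y‖ ^ 2 →
      IsLeast (fidelityDistance ρ '' partialIncoherentStates (Fin 2) (Fin 2))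
        (fidelityPartialCoherence ρ) ∧
      fidelityPartialCoherence ρ =
        1 / 2 * (1 - √((b + c) ^ 2 - 4 * ‖x‖ ^ 2) - √((a + d) ^ 2 - 4 * ‖y‖ ^ 2))) ∧
    (∀ (n : ℕ) (ρ : Matrix (Fin 2 × Fin n) (Fin 2 × Fin n) ℂ),
      IsDensityMatrix ρ → IsUnit ρ → IsXMatrix (flatten ρ) →
      IsLeast (fidelityDistance ρ '' partialIncoherentStates (Fin 2) (Fin n))
        (fidelityPartialCoherence ρ) ∧
      fidelityPartialCoherence ρ =
        1 / 2 * (1 - ∑ i : Fin n,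
          √(((flatten ρ (lowIdx i) (lowIdx i)).re
              + (flatten ρ (lowIdx i).rev (lowIdx i).rev).re) ^ 2
            - 4 * ‖flatten ρ (lowIdx i).rev (lowIdx i)‖ ^ 2))) := by
  have general : ∀ (n : ℕ) (ρ : Matrix (Fin 2 × Fin n) (Fin 2 × Fin n) ℂ),
      IsDensityMatrix ρ → IsUnit ρ → IsXMatrix (flatten ρ) →
      IsLeast (fidelityDistance ρ '' partialIncoherentStates (Fin 2) (Fin n))
        (fidelityPartialCoherence ρ) ∧
      fidelityPartialCoherence ρ =
        1 / 2 * (1 - ∑ i : Fin n,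
          √(((flatten ρ (lowIdx i) (lowIdx i)).re
              + (flatten ρ (lowIdx i).rev (lowIdx i).rev).re) ^ 2
            - 4 * ‖flatten ρ (lowIdx i).rev (lowIdx i)‖ ^ 2)) := by
    intro n ρ hρ hu hx
    have h := isLeast_fidelityDistance_of_isXMatrix hρ hu hx
    have h2 := h.csInf_eq
    exact ⟨by rw [fidelityPartialCoherence, h2]; exact h, h2⟩
  refine ⟨fun a b c d x y ρ hρ hfl hbc had => ?_, general⟩
  -- The determinant is (ad - |y|²)(bc - |x|²), so the two inequations say exactly that ρ is
  -- invertible.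
  have hu : IsUnit ρ := by
    refine isUnit_of_det_flatten_ne_zero ?_
    rw [hfl]
    refine (det_x_fin_four _ _ _ _ _ _ _ _).trans_ne (mul_ne_zero ?_ ?_)
    · rw [Complex.star_def, Complex.mul_conj, Complex.normSq_eq_norm_sq]
      exact_mod_cast sub_ne_zero.2 had
    · rw [Complex.star_def, Complex.mul_conj, Complex.normSq_eq_norm_sq]
      exact_mod_cast sub_ne_zero.2 hbc
  have hx : IsXMatrix (flatten ρ) := by
    rw [hfl]
    intro (i : Fin 4) (j : Fin 4) h1 h2
    fin_cases i <;> fin_cases j <;> first | rfl | exact absurd rfl h1 | exact absurd rfl h2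
  obtain ⟨h1, h2⟩ := general 2 ρ hρ hu hx
  refine ⟨h1, h2.trans ?_⟩
  have e0 : lowIdx (0 : Fin 2) = (0 : Fin 4) := rfl
  have e1 : lowIdx (1 : Fin 2) = (1 : Fin 4) := rfl
  have r0 : (lowIdx (0 : Fin 2)).rev = (3 : Fin 4) := rfl
  have r1 : (lowIdx (1 : Fin 2)).rev = (2 : Fin 4) := rfl
  have f00 : flatten ρ (0 : Fin 4) (0 : Fin 4) = a := congrFun (congrFun hfl _) _
  have f33 : flatten ρ (3 : Fin 4) (3 : Fin 4) = d := congrFun (congrFun hfl _) _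
  have f30 : flatten ρ (3 : Fin 4) (0 : Fin 4) = star y := congrFun (congrFun hfl _) _
  have f11 : flatten ρ (1 : Fin 4) (1 : Fin 4) = b := congrFun (congrFun hfl _) _
  have f22 : flatten ρ (2 : Fin 4) (2 : Fin 4) = c := congrFun (congrFun hfl _) _
  have f21 : flatten ρ (2 : Fin 4) (1 : Fin 4) = star x := congrFun (congrFun hfl _) _
  rw [Fin.sum_univ_two, r0, r1, e0, e1, f00, f33, f30, f11, f22, f21, norm_star, norm_star]
  simp only [Complex.ofReal_re]
  ring
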